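/- Let $X$ be a smooth projective variety over $\mathbb{C}$ of dimension $n$ (a compact connected complex manifold admitting a very ample line bundle) of nonnegative Kodaira dimension, i.e. $\Gamma(X,\mathcal{O}_X(mK_X))\neq 0$ for some $m\geq 1$. Integrals $\int_X|\sigma\wedge\bar\sigma|^{1/m}$ are taken with the nonnegative $(n,n)$-form equal to $|f|^{2/m}\,|dz_1\wedge\cdots\wedge dz_n|^2$ where $\sigma=f\,(dz_1\wedge\cdots\wedge dz_n)^{m}$, with $|dz_1\wedge\cdots\wedge dz_n|^2=(\sqrt{-1})^{n^2}dz\wedge d\bar z$, $dz=dz_1\wedge\cdots\wedge dz_n$ (for sections of $A+mK_X$ one includes the factor $h_A^{1/m}$). The lower envelope of a $[0,\infty]$-valued metric is its lower semicontinuous envelope, and $0^{-1}=+\infty$. Put $$K_m(x)=\sup\Big\{|\sigma|^{2/m}(x)\;;\;\sigma\in\Gamma(X,\mathcal{O}_X(mK_X)),\ \int_X|\sigma\wedge\bar\sigma|^{1/m}=1\Big\},\qquad K_\infty=\limsup_{m\to\infty}K_m,$$ where a supremum over the empty set is $0$, and let $h_{can}$, the canonical AZD (analytic Zariski decomposition),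 be the lower envelope of $K_\infty^{-1}$, a metric on $K_X$. For an ample line bundle $A$ on $X$ with a $C^\infty$ hermitian metric $h_A$ put $$\hat K_m^A(x)=\sup\Big\{|\sigma|^{2/m}(x)\;;\;\sigma\in\Gamma(X,\mathcal{O}_X(A+mK_X)),\ \Big(\int_X h_A^{1/m}|\sigma\wedge\bar\sigma|^{1/m}\Big)^{m/2}=1\Big\},\qquad \hat K_\infty^A=\limsup_{m\to\infty}h_A^{1/m}\hat K_m^A,$$ let $\hat h_{can,A}$ be the lower envelope of $(\hat K_\infty^A)^{-1}$ (it does not depend on $h_A$), and let the supercanonical AZD $\hat h_{can}$ be the lower envelope of the pointwise infimum $\inf_A\hat h_{can,A}$ over all ample line bundles $A$ on $X$. Call $A$ sufficiently ample if it is ample and, for every holomorphic line bundle $L$ on $X$ with a singular hermitian metric $h_L$ (lower semicontinuous, with $L^1_{loc}$ local weights) of semipositive curvature current, $\mathcal{O}_X(A+L)\otimes\mathcal{I}(h_L)$ and $\mathcal{O}_X(K_X+A+L)\otimes\mathcal{I}(h_L)$ are globally generated, $\mathcal{I}(h_L)$ being the multiplier ideal sheaf. Then for every sufficiently ample line bundle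 $A$ on $X$ and every $C^\infty$ hermitian metric $h_A$ on $A$, $\hat h_{can,A}\leq h_{can}$ holds at every point of $X$. In particular $\hat h_{can}\leq h_{can}$ on $X$; equivalently, the volume forms satisfy $\hat h_{can}^{-1}\geq h_{can}^{-1}$ on $X$. -/

import Mathlib

open Set Filter Topology MeasureTheory
open scoped Manifold ContDiff ENNReal

universe u

namespace Supercanonical

/-- The model of `n`-dimensional complex manifolds: `ℂⁿ` over `ℂ`. A complex manifold of dimension
`n` is a space charted on `Fin n → ℂ` with `IsManifold (model n) ω X` (analytic over `ℂ`, that is,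
holomorphic changes of coordinates). -/
noncomputable abbrev model (n : ℕ) : ModelWithCorners ℂ (Fin n → ℂ) (Fin n → ℂ) := 𝓘(ℂ, Fin n → ℂ)

/-- The index set of the coordinate charts of `X`. -/
abbrev Chart (n : ℕ) (X : Type u) [TopologicalSpace X] [ChartedSpace (Fin n → ℂ) X] : Type u :=
  atlas (Fin n → ℂ) X

/-- `f` is a holomorphic function on the set `V`. -/
abbrev IsHolOn (n : ℕ) {X : Type u} [TopologicalSpace X] [ChartedSpace (Fin n → ℂ) X]
    (f : X → ℂ) (V : Set X) : Prop :=
  ContMDiffOn (model n) 𝓘(ℂ, ℂ) ω f V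

/-! ### Holomorphic line bundles -/

/-- A holomorphic line bundle on `X`, given by an open cover with frames `e i` on `U i` and
holomorphic transition functions: `e i = g i j • e j` on `U i ∩ U j`, that is, the coefficients of a
section `f i • e i = f j • e j` satisfy `f j = g i j * f i`. -/
structure HolLineBundle (n : ℕ) (X : Type u) [TopologicalSpace X]
    [ChartedSpace (Fin n → ℂ) X] where
  ι : Type u
  U : ι → Set X
  isOpen_U : ∀ i, IsOpen (U i)
  indexAt : X → ι
  mem_U_at : ∀ x, x ∈ U (indexAt x)
  g : ι → ι → X → ℂ
  hol : ∀ i j, IsHolOn n (g i j) (U i ∩ U j)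
  g_self : ∀ i, ∀ x ∈ U i, g i i x = 1
  g_comp : ∀ i j k, ∀ x ∈ U i ∩ U j ∩ U k, g j k x * g i j x = g i k x

section

variable {n : ℕ} {X : Type u} [TopologicalSpace X] [ChartedSpace (Fin n → ℂ) X]

/-- The tensor product `L ⊗ M` (written `L + M` in additive notation), with frames
`e i ⊗ e j` on `U i ∩ U j`. -/
def HolLineBundle.tensor (L M : HolLineBundle n X) : HolLineBundle n X where
  ι := L.ι × M.ι
  U p := L.U p.1 ∩ M.U p.2
  isOpen_U p := (L.isOpen_U p.1).inter (M.isOpen_U p.2)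
  indexAt x := (L.indexAt x, M.indexAt x)
  mem_U_at x := ⟨L.mem_U_at x, M.mem_U_at x⟩
  g p q x := L.g p.1 q.1 x * M.g p.2 q.2 x
  hol p q := by
    refine ContMDiffOn.mul (I := 𝓘(ℂ, ℂ)) (G := ℂ) ?_ ?_
    · exact (L.hol p.1 q.1).mono fun x hx => ⟨hx.1.1, hx.2.1⟩
    · exact (M.hol p.2 q.2).mono fun x hx => ⟨hx.1.2, hx.2.2⟩
  g_self p x hx := by simp [L.g_self p.1 x hx.1, M.g_self p.2 x hx.2]
  g_comp p q r x hx := by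
    rw [← L.g_comp p.1 q.1 r.1 x ⟨⟨hx.1.1.1, hx.1.2.1⟩, hx.2.1⟩,
      ← M.g_comp p.2 q.2 r.2 x ⟨⟨hx.1.1.2, hx.1.2.2⟩, hx.2.2⟩]
    ring

/-- The tensor power `L^{⊗ m}` (written `m L` in additive notation). -/
def HolLineBundle.pow (L : HolLineBundle n X) (m : ℕ) : HolLineBundle n X where
  ι := L.ι
  U := L.U
  isOpen_U := L.isOpen_U
  indexAt := L.indexAt
  mem_U_at := L.mem_U_at
  g i j x := L.g i j x ^ m
  hol i j := contDiff_id.pow m |>.contMDiff.comp_contMDiffOn (L.hol i j)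
  g_self i x hx := by simp [L.g_self i x hx]
  g_comp i j k x hx := by rw [← mul_pow, L.g_comp i j k x hx]

/-- `s` is (the family of coefficients, in the frames, of) a holomorphic section of `L` over the
open set `V`. Only the values of `s i` on `U i ∩ V` matter. -/
def HolLineBundle.IsSection (L : HolLineBundle n X) (V : Set X) (s : L.ι → X → ℂ) : Prop :=
  (∀ i, IsHolOn n (s i) (L.U i ∩ V)) ∧
    ∀ i j, ∀ x ∈ L.U i ∩ L.U j ∩ V, s j x = L.g i j x * s i x

/-- `L` is very ample: finitely many global sections of `L` define a holomorphic embedding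
`x ↦ [s 0 x : ⋯ : s N x]` of `X` in `ℙ^N`. In each frame: the sections have no common zero, the map
is injective, and it is an immersion (a tangent vector whose image under the differential of the
affine lift lies in the line spanned by the lift is zero). For compact `X` this is an embedding. -/
def HolLineBundle.IsVeryAmple (L : HolLineBundle n X) : Prop :=
  ∃ (N : ℕ) (s : Fin (N + 1) → L.ι → X → ℂ),
    (∀ k, L.IsSection univ (s k)) ∧
    (∀ i, ∀ x ∈ L.U i, ∃ k, s k i x ≠ 0) ∧
    (∀ i j, ∀ x ∈ L.U i, ∀ y ∈ L.U j, ∀ a : ℂ, (∀ k, s k j y = a * s k i x) → x = y) ∧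
    (∀ i, ∀ x ∈ L.U i, ∀ (v : TangentSpace (model n) x) (a : ℂ),
      (∀ k, mfderiv (model n) 𝓘(ℂ, ℂ) (s k i) x v = a * s k i x) → v = 0)

/-- `L` is ample: some positive power of `L` is very ample. -/
def HolLineBundle.IsAmple (L : HolLineBundle n X) : Prop :=
  ∃ k : ℕ, 0 < k ∧ (L.pow k).IsVeryAmple

/-- The coordinate domain, in the chart `c`, of a subset `V` of `X`. -/
def coordSet (c : Chart n X) (V : Set X) : Set (Fin n → ℂ) :=
  c.1.target ∩ c.1.symm ⁻¹' V

/-- A `C^∞` hermitian metric on `L`; `val i x` is the squared length of the frame `e i` at `x`. -/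
structure HermitianMetric (L : HolLineBundle n X) where
  val : L.ι → X → ℝ
  pos : ∀ i, ∀ x ∈ L.U i, 0 < val i x
  smooth : ∀ i (c : Chart n X),
    ContDiffOn ℝ (⊤ : ℕ∞) (fun z => val i (c.1.symm z)) (coordSet c (L.U i))
  compat : ∀ i j, ∀ x ∈ L.U i ∩ L.U j, val i x = ‖L.g i j x‖ ^ 2 * val j x

/-! ### Singular hermitian metrics, curvature, multiplier ideals -/

/-- The local weight `φ = - log h` of `h`, so that `h = e^{-φ}`. -/
noncomputable def weight (h : ℝ≥0∞) : ℝ := -(ENNReal.log h).toReal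

/-- A singular hermitian metric on `L`: lower semicontinuous, `[0, ∞]`-valued, and of the form
`e^{-φ}` with `φ` locally integrable in every coordinate chart and frame; `val i x` is the squared
length of the frame `e i` at `x`. -/
structure SingularMetric (L : HolLineBundle n X) where
  val : L.ι → X → ℝ≥0∞
  lsc : ∀ i, LowerSemicontinuousOn (val i) (L.U i)
  compat : ∀ i j, ∀ x ∈ L.U i ∩ L.U j, val i x = ‖L.g i j x‖ₑ ^ 2 * val j x
  ae_finite : ∀ i (c : Chart n X), ∀ᵐ z ∂(volume.restrict (coordSet c (L.U i))),
    val i (c.1.symm z) ≠ 0 ∧ val i (c.1.symm z) ≠ ⊤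
  locInt : ∀ i (c : Chart n X),
    LocallyIntegrableOn (fun z => weight (val i (c.1.symm z))) (coordSet c (L.U i)) volume

/-- Four times the Levi form `∑ v_j v̄_k ∂²χ/∂z_j∂z̄_k` of a real function `χ` on `ℂⁿ`. -/
noncomputable def leviForm (χ : (Fin n → ℂ) → ℝ) (z v : Fin n → ℂ) : ℝ :=
  iteratedFDeriv ℝ 2 χ z ![v, v] +
    iteratedFDeriv ℝ 2 χ z ![Complex.I • v, Complex.I • v]

/-- The curvature current `√-1 Θ_h = √-1 ∂∂̄φ` is semipositive: the distributions
`∑ v_j v̄_k ∂²φ/∂z_j∂z̄_k` are nonnegative for all `v`, in every coordinate chart and frame. -/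
def SingularMetric.IsSemipositive {L : HolLineBundle n X} (h : SingularMetric L) : Prop :=
  ∀ i (c : Chart n X) (v : Fin n → ℂ) (χ : (Fin n → ℂ) → ℝ),
    ContDiff ℝ (⊤ : ℕ∞) χ → HasCompactSupport χ → tsupport χ ⊆ coordSet c (L.U i) → (∀ z, 0 ≤ χ z) →
    0 ≤ ∫ z in coordSet c (L.U i), weight (h.val i (c.1.symm z)) * leviForm χ z v

/-- `s` is a section over `V` of the sheaf `𝒪(M + L) ⊗ 𝓘(h)`, `𝓘(h)` being the multiplier ideal
sheaf of the singular metric `h` on `L`: a holomorphic section of `M ⊗ L` for whose coefficients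
`f` (in frames and coordinates) `|f|² e^{-φ}` is locally integrable. -/
def IsMultiplierSection (M : HolLineBundle n X) {L : HolLineBundle n X} (h : SingularMetric L)
    (V : Set X) (s : M.ι × L.ι → X → ℂ) : Prop :=
  (M.tensor L).IsSection V s ∧
    ∀ (j : M.ι) (i : L.ι) (c : Chart n X) (K : Set (Fin n → ℂ)), IsCompact K →
      K ⊆ coordSet c (M.U j ∩ L.U i ∩ V) →
      ∫⁻ z in K, ‖s (j, i) (c.1.symm z)‖ₑ ^ 2 * h.val i (c.1.symm z) < ⊤

/-- The sheaf `𝒪(M + L) ⊗ 𝓘(h)` is globally generated: each of its stalks is generated, over the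
ring of germs of holomorphic functions, by global sections. -/
def IsGloballyGenerated (M : HolLineBundle n X) {L : HolLineBundle n X}
    (h : SingularMetric L) : Prop :=
  ∀ (x : X) (V : Set X), IsOpen V → x ∈ V →
    ∀ s : M.ι × L.ι → X → ℂ, IsMultiplierSection M h V s →
    ∃ (W : Set X) (N : ℕ) (a : Fin N → X → ℂ) (t : Fin N → M.ι × L.ι → X → ℂ),
      IsOpen W ∧ x ∈ W ∧ W ⊆ V ∧ (∀ k, IsHolOn n (a k) W) ∧
      (∀ k, IsMultiplierSection M h univ (t k)) ∧
      ∀ p, ∀ y ∈ (M.tensor L).U p ∩ W, s p y = ∑ k, a k y * t k p y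

/-! ### Integration of densities and semicontinuous envelopes -/

/-- The integral over `X` of a nonnegative `(n, n)`-form, given in each chart `c`, with coordinates
`z`, as `ρ c |dz₁ ∧ ⋯ ∧ dzₙ|²`. Here `|dz₁ ∧ ⋯ ∧ dzₙ|²` is `(√-1)^{n²} dz ∧ dz̄`, which is `2ⁿ` times
Lebesgue measure. The integral is the supremum of the sums of the integrals over finitely many
disjoint Borel pieces of `X`, each of which is contained in a coordinate domain; for compact `X`
and a measurable form, the supremum is attained by any such partition of `X`. -/
noncomputable def integralForm (ρ : Chart n X → X → ℝ≥0∞) : ℝ≥0∞ :=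
  ⨆ (N : ℕ) (c : Fin N → Chart n X) (T : Fin N → Set (Fin n → ℂ))
    (_ : ∀ k, MeasurableSet (T k) ∧ T k ⊆ (c k).1.target)
    (_ : Pairwise fun k l => Disjoint ((c k).1.symm '' T k) ((c l).1.symm '' T l)),
    ∑ k, ∫⁻ z in T k, 2 ^ n * ρ (c k) ((c k).1.symm z)

/-- The lower semicontinuous envelope `x ↦ liminf_{y → x} f y` (`y = x` included), the largest lower
semicontinuous function `≤ f`. -/
noncomputable def lowerEnvelope (f : X → ℝ≥0∞) (x : X) : ℝ≥0∞ := liminf f (𝓝 x)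

end

/-- The determinant is holomorphic on the endomorphisms of `ℂⁿ`. -/
theorem contDiff_clmDet {n : ℕ} :
    ContDiff ℂ ω (fun T : (Fin n → ℂ) →L[ℂ] (Fin n → ℂ) => T.det) := by
  have h : (fun T : (Fin n → ℂ) →L[ℂ] (Fin n → ℂ) => T.det) =
      fun T => ∑ σ : Equiv.Perm (Fin n), ((Equiv.Perm.sign σ : ℤ) : ℂ) *
        ∏ i, T (Pi.single i 1) (σ i) := by
    funext T
    rw [ContinuousLinearMap.det, ← LinearMap.det_toMatrix', Matrix.det_apply']
    simp [LinearMap.toMatrix'_apply]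
  rw [h]
  refine ContDiff.sum fun σ _ => contDiff_const.mul (contDiff_prod fun i _ => ?_)
  exact (contDiff_apply ℂ ℂ (σ i)).comp (contDiff_id.clm_apply contDiff_const)

section

variable (n : ℕ) (X : Type u) [TopologicalSpace X] [ChartedSpace (Fin n → ℂ) X]
  [IsManifold (model n) ω X]

/-- The canonical bundle `K_X`, with the frames `dz₁ ∧ ⋯ ∧ dzₙ` on the coordinate domains. Its
transition function from the chart `c` (coordinates `z`) to the chart `c'` (coordinates `w`) is the
Jacobian determinant `det (∂z/∂w)`; `(tangentBundleCore _ X).coordChange c' c x` is the derivative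
at `w(x)` of `z` as a function of `w`. -/
noncomputable def canonicalBundle : HolLineBundle n X where
  ι := Chart n X
  U c := c.1.source
  isOpen_U c := c.1.open_source
  indexAt x := ⟨chartAt _ x, chart_mem_atlas _ x⟩
  mem_U_at x := mem_chart_source _ x
  g c c' x := ((tangentBundleCore (model n) X).coordChange c' c x).det
  hol c c' := by
    have : IsManifold (model n) (ω + 1) X := by simpa using ‹IsManifold (model n) ω X›
    have h := (tangentBundleCore.isContMDiff (I := model n) (n := ω) (M := X)).contMDiffOn_coordChange
      c' c
    have h2 : ContMDiffOn (model n) 𝓘(ℂ, (Fin n → ℂ) →L[ℂ] (Fin n → ℂ)) ω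
        ((tangentBundleCore (model n) X).coordChange c' c) (c.1.source ∩ c'.1.source) :=
      h.mono fun x hx => ⟨hx.2, hx.1⟩
    exact contDiff_clmDet.contMDiff.comp_contMDiffOn h2
  g_self c x hx := by
    have : (tangentBundleCore (model n) X).coordChange c c x = ContinuousLinearMap.id ℂ _ :=
      ContinuousLinearMap.ext fun v => (tangentBundleCore (model n) X).coordChange_self c x hx v
    rw [this]
    simp [ContinuousLinearMap.det]
  g_comp c c' c'' x hx := by
    have h : (tangentBundleCore (model n) X).coordChange c'' c x =
        ((tangentBundleCore (model n) X).coordChange c' c x).comp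
          ((tangentBundleCore (model n) X).coordChange c'' c' x) :=
      ContinuousLinearMap.ext fun v =>
        ((tangentBundleCore (model n) X).coordChange_comp c'' c' c x
          ⟨⟨hx.2, hx.1.2⟩, hx.1.1⟩ v).symm
    rw [h]
    simp only [ContinuousLinearMap.det, ContinuousLinearMap.toLinearMap_comp, LinearMap.det_comp]
    ring

end

section

variable {n : ℕ} {X : Type u} [TopologicalSpace X] [ChartedSpace (Fin n → ℂ) X]
  [IsManifold (model n) ω X]

variable (n X) in
/-- `X` has nonnegative Kodaira dimension: some `m K_X`, `m ≥ 1`, has a nonzero global section. -/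
def NonnegKodairaDim : Prop :=
  ∃ m : ℕ, 0 < m ∧ ∃ s : Chart n X → X → ℂ, ((canonicalBundle n X).pow m).IsSection univ s ∧
    ∃ (c : Chart n X), ∃ x ∈ c.1.source, s c x ≠ 0

/-- `A` is sufficiently ample: it is ample, and for every line bundle `L` with a singular hermitian
metric `h` of semipositive curvature, `𝒪(A + L) ⊗ 𝓘(h)` and `𝒪(K_X + A + L) ⊗ 𝓘(h)` are globally
generated. -/
def IsSufficientlyAmple (A : HolLineBundle n X) : Prop :=
  A.IsAmple ∧ ∀ (L : HolLineBundle n X) (h : SingularMetric L), h.IsSemipositive →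
    IsGloballyGenerated A h ∧ IsGloballyGenerated ((canonicalBundle n X).tensor A) h

/-! ### The canonical AZD

Sections of `K_X^{-1}`-type objects (metrics on `K_X`) and volume forms are described by their
coefficients in each chart `c`: a form `ρ c |dz₁ ∧ ⋯ ∧ dzₙ|²` by `ρ c`, and a (singular) hermitian
metric on `K_X` by the squared length of the frame `dz₁ ∧ ⋯ ∧ dzₙ`; these values are meaningful on the
domain of `c`. The metric attached to the form `ρ` is its inverse, with `0⁻¹ = ∞`. -/

/-- `K_m(x) = sup { |σ|^{2/m}(x) ; σ ∈ Γ(X, m K_X), ∫_X |σ ∧ σ̄|^{1/m} = 1 }`. -/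
noncomputable def kernelCan (m : ℕ) (c : Chart n X) (x : X) : ℝ≥0∞ :=
  ⨆ (s : Chart n X → X → ℂ) (_ : ((canonicalBundle n X).pow m).IsSection univ s)
    (_ : integralForm (fun c' y => ‖s c' y‖ₑ ^ (2 / m : ℝ)) = 1), ‖s c x‖ₑ ^ (2 / m : ℝ)

/-- `K_∞ = limsup_m K_m`, pointwise. -/
noncomputable def kernelCanLim (c : Chart n X) (x : X) : ℝ≥0∞ :=
  limsup (fun m : ℕ => kernelCan m c x) atTop

/-- The canonical AZD `h_can`, the lower envelope of `K_∞⁻¹`. -/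
noncomputable def hCan (c : Chart n X) : X → ℝ≥0∞ :=
  lowerEnvelope fun x => (kernelCanLim c x)⁻¹

/-! ### The supercanonical AZD -/

/-- `‖σ‖_{1/m} = (∫_X h_A^{1/m} |σ ∧ σ̄|^{1/m})^{m/2}` for `σ ∈ Γ(X, A + m K_X)`. -/
noncomputable def normA {A : HolLineBundle n X} (hA : HermitianMetric A) (m : ℕ)
    (s : A.ι × Chart n X → X → ℂ) : ℝ≥0∞ :=
  integralForm (fun c y => ENNReal.ofReal (hA.val (A.indexAt y) y) ^ (1 / m : ℝ) *
    ‖s (A.indexAt y, c) y‖ₑ ^ (2 / m : ℝ)) ^ (m / 2 : ℝ)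

/-- `K̂_m^A(x) = sup { |σ|^{2/m}(x) ; σ ∈ Γ(X, A + m K_X), ‖σ‖_{1/m} = 1 }`, as its coefficient with
respect to the frame `i` of `A` and the chart `c`. -/
noncomputable def kernelA {A : HolLineBundle n X} (hA : HermitianMetric A) (m : ℕ)
    (i : A.ι) (c : Chart n X) (x : X) : ℝ≥0∞ :=
  ⨆ (s : A.ι × Chart n X → X → ℂ)
    (_ : (A.tensor ((canonicalBundle n X).pow m)).IsSection univ s)
    (_ : normA hA m s = 1), ‖s (i, c) x‖ₑ ^ (2 / m : ℝ)

/-- `K̂_∞^A = limsup_m h_A^{1/m} · K̂_m^A`, pointwise. -/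
noncomputable def kernelALim {A : HolLineBundle n X} (hA : HermitianMetric A)
    (c : Chart n X) (x : X) : ℝ≥0∞ :=
  limsup (fun m : ℕ => ENNReal.ofReal (hA.val (A.indexAt x) x) ^ (1 / m : ℝ) *
    kernelA hA m (A.indexAt x) c x) atTop

/-- The metric `ĥ_{can,A}`, the lower envelope of `(K̂_∞^A)⁻¹`. -/
noncomputable def hCanA {A : HolLineBundle n X} (hA : HermitianMetric A)
    (c : Chart n X) : X → ℝ≥0∞ :=
  lowerEnvelope fun x => (kernelALim hA c x)⁻¹

/-- The supercanonical AZD `ĥ_can`, the lower envelope of the pointwise infimum of the `ĥ_{can,A}`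
over all ample line bundles `A` (with their `C^∞` hermitian metrics; `ĥ_{can,A}` does not depend on
the metric). -/
noncomputable def hSupercan (c : Chart n X) : X → ℝ≥0∞ :=
  lowerEnvelope fun x =>
    ⨅ (A : HolLineBundle n X) (_ : A.IsAmple) (hA : HermitianMetric A), hCanA hA c x

end

end Supercanonical

namespace Supercanonical

section

variable {n : ℕ} {X : Type u} [TopologicalSpace X] [ChartedSpace (Fin n → ℂ) X]

/-! ### Integrals of densities -/

/-! Fix a point `x` and a global section `τ` of `A` with `τ(x) ≠ 0`. By compactness `|τ|² ≤ C` on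
`X`. Multiplication by `τ` sends `Γ(X, mK_X)` to `Γ(X, A + mK_X)` and increases the integral of the
`2/m`-th power by a factor of at most `C^{1/m}`. Rescaling `τσ` to norm one gives `(|τ|²(x)/C)^{1/m}
K_m(x) ≤ h_A^{1/m} K̂_m^A(x)` (`mul_kernelCan_le`). The factor tends to `1`, so `K_∞ ≤ K̂_∞^A`
pointwise (`limsup_le_limsup_of_rpow_mul_le`). Inversion reverses the inequality, and lower
envelopes preserve it.

If `A` is sufficiently ample, `τ` comes from global generation for the trivial bundle with its flat
metric (`exists_section_ne_zero`). For the supercanonical AZD a single ample bundle without base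
points suffices. Projectivity provides a very ample one, and its sections give the Fubini–Study
metric. -/

theorem integralForm_le_mul {ρ ρ' : Chart n X → X → ℝ≥0∞} {C : ℝ≥0∞} (hC : C ≠ ⊤)
    (h : ∀ (c : Chart n X), ∀ y ∈ c.1.source, ρ c y ≤ C * ρ' c y) :
    integralForm ρ ≤ C * integralForm ρ' := by
  refine iSup_le fun N => iSup_le fun c => iSup_le fun T => iSup_le fun hT => iSup_le fun hd => ?_
  have h1 : ∑ k, ∫⁻ z in T k, 2 ^ n * ρ (c k) ((c k).1.symm z) ≤
      C * ∑ k, ∫⁻ z in T k, 2 ^ n * ρ' (c k) ((c k).1.symm z) := by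
    rw [Finset.mul_sum]
    refine Finset.sum_le_sum fun k _ => ?_
    -- Finiteness of `C` allows it to be pulled out without measurability of the density.
    rw [← lintegral_const_mul' _ _ hC]
    refine setLIntegral_mono' (hT k).1 fun z hz => ?_
    calc 2 ^ n * ρ (c k) ((c k).1.symm z)
        ≤ 2 ^ n * (C * ρ' (c k) ((c k).1.symm z)) := by
          gcongr
          exact h _ _ ((c k).1.map_target ((hT k).2 hz))
      _ = C * (2 ^ n * ρ' (c k) ((c k).1.symm z)) := by ring
  refine h1.trans (mul_le_mul_right ?_ C)
  exact le_iSup_of_le N <| le_iSup_of_le c <| le_iSup_of_le T <| le_iSup_of_le hT <|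
    le_iSup_of_le hd le_rfl

theorem integralForm_const_mul (ρ : Chart n X → X → ℝ≥0∞) {C : ℝ≥0∞} (h0 : C ≠ 0) (hC : C ≠ ⊤) :
    integralForm (fun c y => C * ρ c y) = C * integralForm ρ := by
  refine le_antisymm (integralForm_le_mul hC fun c y _ => le_rfl) ?_
  have h : integralForm ρ ≤ C⁻¹ * integralForm (fun c y => C * ρ c y) :=
    integralForm_le_mul (ENNReal.inv_ne_top.2 h0) fun c y _ => by
      rw [← mul_assoc, ENNReal.inv_mul_cancel h0 hC, one_mul]
  calc C * integralForm ρ ≤ C * (C⁻¹ * integralForm (fun c y => C * ρ c y)) := by gcongr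
    _ = integralForm (fun c y => C * ρ c y) := by
      rw [← mul_assoc, ENNReal.mul_inv_cancel h0 hC, one_mul]

/-- By continuity the density exceeds some `ε > 0` on a nonempty open set of the chart, which has
positive Lebesgue measure and is an admissible one-piece family. -/
theorem integralForm_ne_zero {ρ : Chart n X → X → ℝ≥0∞} (c : Chart n X)
    (hρ : ContinuousOn (ρ c) c.1.source) {x : X} (hx : x ∈ c.1.source) (h0 : ρ c x ≠ 0) :
    integralForm ρ ≠ 0 := by
  obtain ⟨ε, hε, hεx⟩ := exists_between (pos_iff_ne_zero.2 h0)
  have hcont : ContinuousOn (fun z => ρ c (c.1.symm z)) c.1.target :=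
    hρ.comp c.1.continuousOn_symm fun z hz => c.1.map_target hz
  set W : Set (Fin n → ℂ) := c.1.target ∩ (fun z => ρ c (c.1.symm z)) ⁻¹' Ioi ε with hW
  have hWo : IsOpen W := hcont.isOpen_inter_preimage c.1.open_target isOpen_Ioi
  have hWx : c.1 x ∈ W := ⟨c.1.map_source hx, by simpa [c.1.left_inv hx] using hεx⟩
  have hle : ∫⁻ z in W, 2 ^ n * ρ c (c.1.symm z) ≤ integralForm ρ := by
    refine le_iSup_of_le 1 <| le_iSup_of_le (fun _ => c) <| le_iSup_of_le (fun _ => W) <|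
      le_iSup_of_le (fun _ => ⟨hWo.measurableSet, inter_subset_left⟩) <|
      le_iSup_of_le (fun k l hkl => absurd (Subsingleton.elim k l) hkl) ?_
    simp
  have hpos : 0 < ∫⁻ z in W, 2 ^ n * ρ c (c.1.symm z) := by
    calc 0 < 2 ^ n * ε * volume W :=
          ENNReal.mul_pos (mul_ne_zero (by simp) hε.ne') (hWo.measure_pos volume ⟨_, hWx⟩).ne'
      _ = ∫⁻ _ in W, 2 ^ n * ε := by rw [setLIntegral_const]
      _ ≤ _ := by
        refine setLIntegral_mono' hWo.measurableSet fun z hz => ?_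
        gcongr
        exact hz.2.le
  exact (hpos.trans_le hle).ne'

/-! ### Sections and metrics -/

theorem isSection_mul {L M : HolLineBundle n X} {V : Set X} {s : L.ι → X → ℂ} {t : M.ι → X → ℂ}
    (hs : L.IsSection V s) (ht : M.IsSection V t) (a : ℂ) :
    (L.tensor M).IsSection V fun p y => a * (s p.1 y * t p.2 y) := by
  refine ⟨fun p => ?_, fun p q y hy => ?_⟩
  · have h1 : IsHolOn n (s p.1) ((L.tensor M).U p ∩ V) :=
      (hs.1 p.1).mono fun y hy => ⟨hy.1.1, hy.2⟩
    have h2 : IsHolOn n (t p.2) ((L.tensor M).U p ∩ V) :=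
      (ht.1 p.2).mono fun y hy => ⟨hy.1.2, hy.2⟩
    exact ContMDiffOn.mul (I := 𝓘(ℂ, ℂ)) (G := ℂ) contMDiffOn_const
      (ContMDiffOn.mul (I := 𝓘(ℂ, ℂ)) (G := ℂ) h1 h2)
  · obtain ⟨i, j⟩ := p
    obtain ⟨i', j'⟩ := q
    have h1 : s i' y = L.g i i' y * s i y := hs.2 i i' y ⟨⟨hy.1.1.1, hy.1.2.1⟩, hy.2⟩
    have h2 : t j' y = M.g j j' y * t j y := ht.2 j j' y ⟨⟨hy.1.1.2, hy.1.2.2⟩, hy.2⟩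
    change a * (s i' y * t j' y) = L.g i i' y * M.g j j' y * (a * (s i y * t j y))
    rw [h1, h2]
    ring

theorem HermitianMetric.continuousOn_val {L : HolLineBundle n X} (h : HermitianMetric L)
    (i : L.ι) : ContinuousOn (h.val i) (L.U i) := by
  intro x hx
  refine ContinuousAt.continuousWithinAt ?_
  let c : Chart n X := ⟨chartAt _ x, chart_mem_atlas _ x⟩
  have hxc : x ∈ c.1.source := mem_chart_source _ x
  have hopen : IsOpen (coordSet c (L.U i)) :=
    c.1.continuousOn_symm.isOpen_inter_preimage c.1.open_target (L.isOpen_U i)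
  have hmem : c.1 x ∈ coordSet c (L.U i) :=
    ⟨c.1.map_source hxc, by simpa [c.1.left_inv hxc] using hx⟩
  have h1 : ContinuousAt (fun z => h.val i (c.1.symm z)) (c.1 x) :=
    (h.smooth i c).continuousOn.continuousAt (hopen.mem_nhds hmem)
  have h2 : ContinuousAt (fun y => h.val i (c.1.symm (c.1 y))) x :=
    ContinuousAt.comp (f := c.1) h1 (c.1.continuousAt hxc)
  refine h2.congr ?_
  filter_upwards [c.1.open_source.mem_nhds hxc] with y hy
  rw [c.1.left_inv hy]

/-- The squared pointwise norm `|τ|²_h` of a section `τ`. -/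
noncomputable def HermitianMetric.normSq {L : HolLineBundle n X} (h : HermitianMetric L)
    (τ : L.ι → X → ℂ) (y : X) : ℝ :=
  h.val (L.indexAt y) y * ‖τ (L.indexAt y) y‖ ^ 2

/-- The frame `L.indexAt y` may jump with `y`. Independence of the frame lets continuity be checked
in one fixed frame. -/
theorem HermitianMetric.normSq_eq {L : HolLineBundle n X} (h : HermitianMetric L)
    {τ : L.ι → X → ℂ} (hτ : L.IsSection univ τ) (i : L.ι) {y : X} (hy : y ∈ L.U i) :
    h.normSq τ y = h.val i y * ‖τ i y‖ ^ 2 := by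
  have hy' := L.mem_U_at y
  rw [normSq, h.compat i (L.indexAt y) y ⟨hy, hy'⟩, hτ.2 i (L.indexAt y) y ⟨⟨hy, hy'⟩, trivial⟩,
    norm_mul]
  ring

theorem HermitianMetric.continuous_normSq {L : HolLineBundle n X} (h : HermitianMetric L)
    {τ : L.ι → X → ℂ} (hτ : L.IsSection univ τ) : Continuous (h.normSq τ) := by
  refine continuous_iff_continuousAt.2 fun x => ?_
  have hU := (L.isOpen_U (L.indexAt x)).mem_nhds (L.mem_U_at x)
  have h1 : ContinuousAt (h.val (L.indexAt x)) x := (h.continuousOn_val _).continuousAt hU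
  have h2 : ContinuousAt (τ (L.indexAt x)) x :=
    (hτ.1 (L.indexAt x)).continuousOn.continuousAt (by simpa using hU)
  refine (h1.mul (h2.norm.pow 2)).congr ?_
  filter_upwards [hU] with y hy
  exact (h.normSq_eq hτ _ hy).symm

/-- This splits the integrand of `normA` for a product section `a τ σ` into the constant `|a|^{2/m}`
and the density `|τ|^{2/m} |σ|^{2/m}`. -/
theorem HermitianMetric.ofReal_rpow_mul {L : HolLineBundle n X} (h : HermitianMetric L)
    (τ : L.ι → X → ℂ) (y : X) (a w : ℂ) (m : ℕ) :
    ENNReal.ofReal (h.val (L.indexAt y) y) ^ (1 / m : ℝ) *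
        ‖a * (τ (L.indexAt y) y * w)‖ₑ ^ (2 / m : ℝ) =
      ‖a‖ₑ ^ (2 / m : ℝ) * (ENNReal.ofReal (h.normSq τ y) ^ (1 / m : ℝ) * ‖w‖ₑ ^ (2 / m : ℝ)) := by
  have h1 : (0 : ℝ) ≤ 1 / m := by positivity
  have h2 : (0 : ℝ) ≤ 2 / m := by positivity
  have h3 : ENNReal.ofReal (h.normSq τ y) =
      ENNReal.ofReal (h.val (L.indexAt y) y) * ‖τ (L.indexAt y) y‖ₑ ^ 2 := by
    rw [normSq, ENNReal.ofReal_mul (h.pos _ _ (L.mem_U_at y)).le,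
      ENNReal.ofReal_pow (norm_nonneg _), ofReal_norm]
  have h4 : (‖τ (L.indexAt y) y‖ₑ ^ 2) ^ (1 / m : ℝ) = ‖τ (L.indexAt y) y‖ₑ ^ (2 / m : ℝ) := by
    rw [← ENNReal.rpow_natCast, ← ENNReal.rpow_mul]
    congr 1
    push_cast
    ring
  rw [h3, ENNReal.mul_rpow_of_nonneg _ _ h1, h4, enorm_mul, enorm_mul,
    ENNReal.mul_rpow_of_nonneg _ _ h2, ENNReal.mul_rpow_of_nonneg _ _ h2]
  ring

end

section

variable {n : ℕ} {X : Type u} [TopologicalSpace X] [ChartedSpace (Fin n → ℂ) X]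
  [IsManifold (model n) ω X]

/-! ### Comparison of the kernels -/

/-- Multiplication by a section `τ` of `A` with `|τ|² ≤ C` compares `K_m` and `K̂_m^A`. -/
theorem mul_kernelCan_le {A : HolLineBundle n X} (hA : HermitianMetric A) {τ : A.ι → X → ℂ}
    (hτ : A.IsSection univ τ) {C : ℝ} (hC : ∀ y, hA.normSq τ y ≤ C) {x : X}
    (hτx : 0 < hA.normSq τ x) (c : Chart n X) (hx : x ∈ c.1.source) {m : ℕ} (hm : 0 < m) :
    ENNReal.ofReal (hA.normSq τ x / C) ^ (1 / m : ℝ) * kernelCan m c x ≤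
      ENNReal.ofReal (hA.val (A.indexAt x) x) ^ (1 / m : ℝ) *
        kernelA hA m (A.indexAt x) c x := by
  have hC0 : 0 < C := hτx.trans_le (hC x)
  have hm' : (0 : ℝ) < m := by exact_mod_cast hm
  have h1 : (0 : ℝ) ≤ 1 / m := by positivity
  have h2 : (0 : ℝ) < 2 / m := by positivity
  simp only [kernelCan, ENNReal.mul_iSup]
  refine iSup_le fun s => iSup_le fun hs => iSup_le fun hI => ?_
  -- A section vanishing at `x` contributes nothing to the supremum. Otherwise `τσ` is nonzero at
  -- `x`, so its integral `I` is positive and can be normalised.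
  rcases eq_or_ne (s c x) 0 with h0 | h0
  · simp [h0, hm]
  set ρ : Chart n X → X → ℝ≥0∞ := fun c y =>
    ENNReal.ofReal (hA.normSq τ y) ^ (1 / m : ℝ) * ‖s c y‖ₑ ^ (2 / m : ℝ)
  set I := integralForm ρ
  have hCm : ENNReal.ofReal C ^ (1 / m : ℝ) ≠ ⊤ := ENNReal.rpow_ne_top_of_nonneg h1 (by simp)
  have hIle : I ≤ ENNReal.ofReal C ^ (1 / m : ℝ) := by
    have := integralForm_le_mul (ρ := ρ) (ρ' := fun c y => ‖s c y‖ₑ ^ (2 / m : ℝ)) hCm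
      (fun c y _ =>
        mul_le_mul_left (ENNReal.rpow_le_rpow (ENNReal.ofReal_le_ofReal (hC y)) h1) _)
    rwa [hI, mul_one] at this
  have hItop : I ≠ ⊤ := ne_top_of_le_ne_top hCm hIle
  have hI0 : I ≠ 0 := by
    refine integralForm_ne_zero c ?_ hx ?_
    · have ha : Continuous fun y => ENNReal.ofReal (hA.normSq τ y) ^ (1 / m : ℝ) :=
        ENNReal.continuous_rpow_const.comp
          (ENNReal.continuous_ofReal.comp (hA.continuous_normSq hτ))
      have hsc : ContinuousOn (s c) c.1.source := by
        have := (hs.1 c).continuousOn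
        rwa [inter_univ] at this
      have hb : ContinuousOn (fun y => ‖s c y‖ₑ ^ (2 / m : ℝ)) c.1.source :=
        ENNReal.continuous_rpow_const.comp_continuousOn hsc.enorm
      intro y hy
      refine ENNReal.Tendsto.mul ha.continuousWithinAt (Or.inr ?_) (hb y hy) (Or.inr ?_)
      · exact ENNReal.rpow_ne_top_of_nonneg h2.le enorm_ne_top
      · exact ENNReal.rpow_ne_top_of_nonneg h1 ENNReal.ofReal_ne_top
    · refine mul_ne_zero ?_ ?_
      · simp [ENNReal.rpow_eq_zero_iff, hτx]
      · simp [ENNReal.rpow_eq_zero_iff, h0, hm]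
  have hItop' : I ^ (-(m / 2) : ℝ) ≠ ⊤ := by
    simp [ENNReal.rpow_eq_top_iff, hI0, hItop]
  -- The exponent `-m/2` makes `|a|^{2/m} = I⁻¹`, so that `a τ σ` has norm one.
  set a : ℂ := ((I ^ (-(m / 2) : ℝ)).toReal : ℂ) with ha
  have haI : ‖a‖ₑ ^ (2 / m : ℝ) = I⁻¹ := by
    have : ‖a‖ₑ = I ^ (-(m / 2) : ℝ) := by
      rw [ha, ← ofReal_norm, Complex.norm_real, Real.norm_of_nonneg ENNReal.toReal_nonneg,
        ENNReal.ofReal_toReal hItop']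
    rw [this, ← ENNReal.rpow_mul, ← ENNReal.rpow_neg_one]
    congr 1
    field_simp
  set t : A.ι × Chart n X → X → ℂ := fun p y => a * (τ p.1 y * s p.2 y) with ht
  have htsec : (A.tensor ((canonicalBundle n X).pow m)).IsSection univ t := isSection_mul hτ hs a
  have htnorm : normA hA m t = 1 := by
    have : integralForm (fun c y => ENNReal.ofReal (hA.val (A.indexAt y) y) ^ (1 / m : ℝ) *
        ‖t (A.indexAt y, c) y‖ₑ ^ (2 / m : ℝ)) = 1 := by
      simp only [ht, hA.ofReal_rpow_mul τ, haI]
      rw [integralForm_const_mul ρ (ENNReal.inv_ne_zero.2 hItop) (ENNReal.inv_ne_top.2 hI0)]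
      exact ENNReal.inv_mul_cancel hI0 hItop
    rw [normA, this, ENNReal.one_rpow]
  have hker : ‖t (A.indexAt x, c) x‖ₑ ^ (2 / m : ℝ) ≤ kernelA hA m (A.indexAt x) c x :=
    le_iSup_of_le t <| le_iSup_of_le htsec <| le_iSup_of_le htnorm le_rfl
  refine le_trans ?_ (mul_le_mul_right hker _)
  simp only [ht, hA.ofReal_rpow_mul τ, haI]
  -- After cancelling common factors what remains is `(C^{1/m})⁻¹ ≤ I⁻¹`, which is `hIle`.
  rw [ENNReal.ofReal_div_of_pos hC0, ENNReal.div_rpow_of_nonneg _ _ h1, div_eq_mul_inv,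
    mul_comm (ENNReal.ofReal (hA.normSq τ x) ^ (1 / m : ℝ)), mul_assoc]
  gcongr

theorem tendsto_rpow_one_div {δ : ℝ≥0∞} (h0 : δ ≠ 0) (htop : δ ≠ ⊤) :
    Tendsto (fun m : ℕ => δ ^ (1 / m : ℝ)) atTop (𝓝 1) := by
  lift δ to NNReal using htop
  have hδ : δ ≠ 0 := by simpa using h0
  have h : Tendsto (fun m : ℕ => δ ^ (1 / m : ℝ)) atTop (𝓝 (δ ^ (0 : ℝ))) :=
    (NNReal.continuousAt_rpow (Or.inl hδ)).tendsto.comp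
      (tendsto_const_nhds.prodMk_nhds tendsto_one_div_atTop_nhds_zero_nat)
  rw [NNReal.rpow_zero] at h
  refine (ENNReal.tendsto_coe.2 h).congr fun m => ?_
  rw [ENNReal.coe_rpow_of_ne_zero hδ]

/-- A factor `δ^{1/m}` does not change an upper limit. -/
theorem limsup_le_limsup_of_rpow_mul_le {δ : ℝ≥0∞} (h0 : δ ≠ 0) (htop : δ ≠ ⊤) {u v : ℕ → ℝ≥0∞}
    (h : ∀ m : ℕ, 0 < m → δ ^ (1 / m : ℝ) * u m ≤ v m) : limsup u atTop ≤ limsup v atTop := by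
  -- Moving the factor to the other side as `δ⁻¹` reduces the claim to submultiplicativity of the
  -- upper limit, whose side conditions hold because this limit is neither `0` nor `∞`.
  have hlim : limsup (fun m : ℕ => δ⁻¹ ^ (1 / m : ℝ)) atTop = 1 :=
    (tendsto_rpow_one_div (ENNReal.inv_ne_zero.2 htop) (ENNReal.inv_ne_top.2 h0)).limsup_eq
  calc limsup u atTop ≤ limsup ((fun m : ℕ => δ⁻¹ ^ (1 / m : ℝ)) * v) atTop := by
        refine limsup_le_limsup ?_
        filter_upwards [eventually_gt_atTop 0] with m hm
        calc u m = δ⁻¹ ^ (1 / m : ℝ) * (δ ^ (1 / m : ℝ) * u m) := by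
              rw [← mul_assoc, ← ENNReal.mul_rpow_of_nonneg _ _ (by positivity),
                ENNReal.inv_mul_cancel h0 htop, ENNReal.one_rpow, one_mul]
          _ ≤ δ⁻¹ ^ (1 / m : ℝ) * v m := by gcongr; exact h m hm
    _ ≤ 1 * limsup v atTop := by
        rw [← hlim]
        exact ENNReal.limsup_mul_le' (Or.inl (hlim ▸ one_ne_zero)) (Or.inl (hlim ▸ ENNReal.one_ne_top))
    _ = limsup v atTop := one_mul _

/-- Both `τ` and the bound `C` may depend on `x`. No uniformity is needed, since the upper limits
are taken pointwise. -/
theorem kernelCanLim_le_kernelALim [CompactSpace X] {A : HolLineBundle n X}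
    (hA : HermitianMetric A) {x : X}
    (hgen : ∃ τ, A.IsSection univ τ ∧ τ (A.indexAt x) x ≠ 0) (c : Chart n X)
    (hx : x ∈ c.1.source) : kernelCanLim c x ≤ kernelALim hA c x := by
  obtain ⟨τ, hτ, hτx⟩ := hgen
  obtain ⟨C, hC⟩ := (isCompact_range (hA.continuous_normSq hτ)).bddAbove
  have hC' : ∀ y, hA.normSq τ y ≤ C := fun y => hC (mem_range_self y)
  have hpos : 0 < hA.normSq τ x :=
    mul_pos (hA.pos _ _ (A.mem_U_at x)) (pow_pos (norm_pos_iff.2 hτx) 2)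
  have hδ : 0 < hA.normSq τ x / C := div_pos hpos (hpos.trans_le (hC' x))
  exact limsup_le_limsup_of_rpow_mul_le (ENNReal.ofReal_pos.2 hδ).ne' ENNReal.ofReal_ne_top
    fun m hm => mul_kernelCan_le hA hτ hC' hpos c hx hm

theorem hCanA_le_hCan [CompactSpace X] {A : HolLineBundle n X} (hA : HermitianMetric A)
    (hgen : ∀ x, ∃ τ, A.IsSection univ τ ∧ τ (A.indexAt x) x ≠ 0) (c : Chart n X) {x : X}
    (hx : x ∈ c.1.source) : hCanA hA c x ≤ hCan c x := by
  refine liminf_le_liminf ?_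
  -- The envelope at `x` only sees points near `x`, and the chart domain is a neighbourhood of `x`.
  filter_upwards [c.1.open_source.mem_nhds hx] with y hy
  exact ENNReal.inv_le_inv.2 (kernelCanLim_le_kernelALim hA (hgen y) c hy)

theorem lowerEnvelope_le (f : X → ℝ≥0∞) (x : X) : lowerEnvelope f x ≤ f x := by
  refine liminf_le_of_le (by isBoundedDefault) fun b hb => hb.self_of_nhds

/-- Near `x` the infimum over ample bundles is at most `hCan`, which lies below the function `K_∞⁻¹`
of which it is the envelope. Comparing envelopes with `K_∞⁻¹` directly avoids taking the envelope of
`hCan` again. -/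
theorem hSupercan_le_hCan [CompactSpace X] {A : HolLineBundle n X} (hample : A.IsAmple)
    (hA : HermitianMetric A) (hgen : ∀ x, ∃ τ, A.IsSection univ τ ∧ τ (A.indexAt x) x ≠ 0)
    (c : Chart n X) {x : X} (hx : x ∈ c.1.source) : hSupercan c x ≤ hCan c x := by
  refine liminf_le_liminf ?_
  filter_upwards [c.1.open_source.mem_nhds hx] with y hy
  calc _ ≤ hCanA hA c y := iInf_le_of_le A <| iInf_le_of_le hample <| iInf_le _ hA
    _ ≤ hCan c y := hCanA_le_hCan hA hgen c hy
    _ ≤ _ := lowerEnvelope_le _ y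

end

section

variable {n : ℕ} {X : Type u} [TopologicalSpace X] [ChartedSpace (Fin n → ℂ) X]

/-! ### Sections of sufficiently ample and very ample bundles -/

/-- The trivial line bundle. -/
def HolLineBundle.trivial (n : ℕ) (X : Type u) [TopologicalSpace X]
    [ChartedSpace (Fin n → ℂ) X] : HolLineBundle n X where
  ι := PUnit
  U _ := univ
  isOpen_U _ := isOpen_univ
  indexAt _ := ⟨⟩
  mem_U_at _ := mem_univ _
  g _ _ _ := 1
  hol _ _ := contMDiffOn_const
  g_self _ _ _ := rfl
  g_comp _ _ _ _ _ := one_mul 1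

theorem weight_one : weight 1 = 0 := by simp [weight]

/-- The flat metric of the trivial line bundle. -/
noncomputable def SingularMetric.trivial (n : ℕ) (X : Type u) [TopologicalSpace X]
    [ChartedSpace (Fin n → ℂ) X] : SingularMetric (HolLineBundle.trivial n X) where
  val _ _ := 1
  lsc _ := lowerSemicontinuousOn_const
  compat _ _ _ _ := by simp [HolLineBundle.trivial]
  ae_finite _ _ := by simp
  locInt i c := by
    simp only [weight_one]
    intro z _
    exact ⟨univ, univ_mem, integrableOn_zero⟩

theorem SingularMetric.isSemipositive_trivial : (SingularMetric.trivial n X).IsSemipositive := by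
  intro i c v χ _ _ _ _
  simp [SingularMetric.trivial, weight_one]

/-- If `𝒪(A) ⊗ 𝓘(h)` is globally generated for the flat metric `h` of the trivial bundle, then `A`
has a global section that does not vanish at a given point. -/
theorem exists_section_ne_zero {A : HolLineBundle n X}
    (hA : IsGloballyGenerated A (SingularMetric.trivial n X)) (x : X) :
    ∃ τ, A.IsSection univ τ ∧ τ (A.indexAt x) x ≠ 0 := by
  set i₀ := A.indexAt x
  have hx := A.mem_U_at x
  -- The local section to be generated is the frame `e i₀`, whose coefficient in the frame `e j` is
  -- `g i₀ j`. Integrability holds because this coefficient is bounded on compact sets.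
  have hs : IsMultiplierSection A (SingularMetric.trivial n X) (A.U i₀)
      (fun p y => A.g i₀ p.1 y) := by
    refine ⟨⟨fun p => (A.hol i₀ p.1).mono fun y hy => ⟨hy.2, hy.1.1⟩, fun p q y hy => ?_⟩, ?_⟩
    · change A.g i₀ q.1 y = A.g p.1 q.1 y * 1 * A.g i₀ p.1 y
      rw [mul_one, A.g_comp i₀ p.1 q.1 y ⟨⟨hy.2, hy.1.1.1⟩, hy.1.2.1⟩]
    · intro j i c K hK hKsub
      have hcont : ContinuousOn (fun z => A.g i₀ j (c.1.symm z)) K :=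
        (A.hol i₀ j).continuousOn.comp (c.1.continuousOn_symm.mono fun z hz => (hKsub hz).1)
          fun z hz => ⟨(hKsub hz).2.2, (hKsub hz).2.1.1⟩
      obtain ⟨C, hC⟩ := hK.exists_bound_of_continuousOn hcont
      calc ∫⁻ z in K, ‖A.g i₀ j (c.1.symm z)‖ₑ ^ 2 *
            (SingularMetric.trivial n X).val i (c.1.symm z)
          ≤ ∫⁻ _ in K, ENNReal.ofReal C ^ 2 := by
            refine setLIntegral_mono' hK.measurableSet fun z hz => ?_
            simp only [SingularMetric.trivial, mul_one]
            gcongr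
            rw [← ofReal_norm]
            exact ENNReal.ofReal_le_ofReal (hC z hz)
        _ = ENNReal.ofReal C ^ 2 * volume K := setLIntegral_const _ _
        _ < ⊤ := ENNReal.mul_lt_top (by simp) hK.measure_lt_top
  obtain ⟨W, N, a, t, -, hxW, -, -, ht, hst⟩ := hA x (A.U i₀) (A.isOpen_U i₀) hx _ hs
  -- The frame has coefficient `1` at `x`, so some global generator is nonzero there.
  have h1 : (1 : ℂ) = ∑ k, a k x * t k (i₀, ⟨⟩) x := by
    rw [← hst (i₀, ⟨⟩) x ⟨⟨hx, mem_univ x⟩, hxW⟩]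
    exact (A.g_self i₀ x hx).symm
  obtain ⟨k, -, hk⟩ := Finset.exists_ne_zero_of_sum_ne_zero (h1 ▸ one_ne_zero)
  refine ⟨fun i => t k (i, ⟨⟩), ⟨fun i => ?_, fun i j y hy => ?_⟩, right_ne_zero_of_mul hk⟩
  · exact ((ht k).1.1 (i, ⟨⟩)).mono fun y hy => ⟨⟨hy.1, mem_univ y⟩, hy.2⟩
  · have h2 : t k (j, ⟨⟩) y = A.g i j y * 1 * t k (i, ⟨⟩) y := (ht k).1.2 (i, ⟨⟩) (j, ⟨⟩) y
      ⟨⟨⟨hy.1.1, mem_univ y⟩, ⟨hy.1.2, mem_univ y⟩⟩, hy.2⟩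
    rwa [mul_one] at h2

/-- The Fubini–Study metric `1 / ∑ |s k|²` given by sections `s k` without common zeros. -/
noncomputable def HermitianMetric.fubiniStudy [IsManifold (model n) ω X] {L : HolLineBundle n X}
    {κ : Type} [Fintype κ] (s : κ → L.ι → X → ℂ) (hs : ∀ k, L.IsSection univ (s k))
    (h0 : ∀ i, ∀ x ∈ L.U i, ∃ k, s k i x ≠ 0) : HermitianMetric L where
  val i x := (∑ k, ‖s k i x‖ ^ 2)⁻¹
  pos i x hx := by
    obtain ⟨k, hk⟩ := h0 i x hx
    exact inv_pos.2 (Finset.sum_pos' (fun _ _ => by positivity) ⟨k, Finset.mem_univ k, by positivity⟩)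
  smooth i c := by
    refine ContDiffOn.inv (ContDiffOn.sum fun k _ => ?_) fun z hz => ?_
    · have h1 : ContMDiffOn (model n) 𝓘(ℂ, ℂ) ω (s k i ∘ c.1.symm) (coordSet c (L.U i)) :=
        ((hs k).1 i).comp
          ((contMDiffOn_symm_of_mem_maximalAtlas (IsManifold.subset_maximalAtlas c.2)).mono
            inter_subset_left) fun z hz => ⟨hz.2, trivial⟩
      have h2 : ContDiffOn ℝ (⊤ : ℕ∞) (s k i ∘ c.1.symm) (coordSet c (L.U i)) :=
        ((contMDiffOn_iff_contDiffOn.1 h1).restrict_scalars ℝ).of_le le_top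
      exact h2.norm_sq ℝ
    · obtain ⟨k, hk⟩ := h0 i _ hz.2
      exact (Finset.sum_pos' (fun _ _ => by positivity)
        ⟨k, Finset.mem_univ k, by positivity⟩).ne'
  compat i j x hx := by
    have hg : ∀ k, s k j x = L.g i j x * s k i x := fun k => (hs k).2 i j x ⟨hx, trivial⟩
    -- If the transition function vanished at `x`, every `s k j x` would be zero.
    have hg0 : ‖L.g i j x‖ ≠ 0 := by
      obtain ⟨k, hk⟩ := h0 j x hx.2
      rw [hg k] at hk
      exact norm_ne_zero_iff.2 (left_ne_zero_of_mul hk)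
    simp only [hg, norm_mul, mul_pow, ← Finset.mul_sum, mul_inv]
    rw [← mul_assoc, mul_inv_cancel₀ (pow_ne_zero 2 hg0), one_mul]

theorem HolLineBundle.IsVeryAmple.isAmple {L : HolLineBundle n X} (hL : L.IsVeryAmple) :
    L.IsAmple := by
  refine ⟨1, one_pos, ?_⟩
  have : L.pow 1 = L := by simp [HolLineBundle.pow]
  rwa [this]

end

end Supercanonical

open Supercanonical in
theorem theorem2p9 (n : ℕ) (X : Type u) [TopologicalSpace X] [T2Space X] [CompactSpace X]
    [ConnectedSpace X] [ChartedSpace (Fin n → ℂ) X] [IsManifold (model n) ω X]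
    (hproj : ∃ L : HolLineBundle n X, L.IsVeryAmple) (hκ : NonnegKodairaDim n X) :
    (∀ A : HolLineBundle n X, IsSufficientlyAmple A → ∀ hA : HermitianMetric A,
      ∀ c : Chart n X, ∀ x ∈ c.1.source, hCanA hA c x ≤ hCan c x) ∧
    (∀ c : Chart n X, ∀ x ∈ c.1.source, hSupercan c x ≤ hCan c x) ∧
    (∀ c : Chart n X, ∀ x ∈ c.1.source, (hCan c x)⁻¹ ≤ (hSupercan c x)⁻¹) := by
  have hsuper : ∀ c : Chart n X, ∀ x ∈ c.1.source, hSupercan c x ≤ hCan c x := by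
    -- The infimum runs over all ample bundles, so the very ample `L` can serve here and no
    -- sufficiently ample bundle has to exist.
    obtain ⟨L, hL⟩ := hproj
    obtain ⟨N, s, hs, h0, -, -⟩ := id hL
    intro c x hx
    refine hSupercan_le_hCan hL.isAmple (HermitianMetric.fubiniStudy s hs h0) (fun y => ?_) c hx
    obtain ⟨k, hk⟩ := h0 (L.indexAt y) y (L.mem_U_at y)
    exact ⟨s k, hs k, hk⟩
  refine ⟨fun A hA h c x hx => hCanA_le_hCan h (fun y => ?_) c hx, hsuper,
    fun c x hx => ENNReal.inv_le_inv.2 (hsuper c x hx)⟩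
  exact exists_section_ne_zero (hA.2 _ _ SingularMetric.isSemipositive_trivial).1 y
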